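/- For $\lambda,x\in\mathbb{C}$ let the Gegenbauer polynomials $C_n^\lambda(x)$ be defined by $\sum_{n\ge0}C_n^\lambda(x)t^n=(1-2xt+t^2)^{-\lambda}$. Put $$R=(1-2xt+t^2)^{1/2},\qquad U=[1-2(1-u)xt+(1-u)^2t^2]^{1/2},$$ with $R=U=1$ at $t=0$. For $\mu\notin\{1,2,3,\dots\}$ the associated Legendre function is $$P_\nu^\mu(z)=\frac{2^\mu}{\Gamma(1-\mu)}(z^2-1)^{-\mu/2}\,{}_2F_1\!\left(-\nu-\mu,\,1+\nu-\mu;\,1-\mu;\,\tfrac{1-z}{2}\right),\qquad z\in\mathbb{C}\setminus(-\infty,1],$$ and the Ferrers function $\mathrm{P}_\nu^\mu(z)$, $z\in\mathbb{C}\setminus\big((-\infty,-1]\cup[1,\infty)\big)$, is given by the same formula with $1-z^2$ in place of $z^2-1$; the powers of $z^2-1$ (resp. $1-z^2$) are the branches that are analytic on these domains and take principal values for real $z>1$ (resp. $-1<z<1$). **Theorem.** Let $\mu\in\mathbb{C}$ with $\mu\notin\{1/2,1,3/2,\dots\}$, and let $u,x\in\mathbb{C}$ be arbitrary. For every $\nu\in\mathbb{C}$,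 $$\sum_{n=0}^\infty {}_2F_1(-n,\,\nu-\mu+1;\,1-2\mu;\,u)\,C_n^{1/2-\mu}(x)\,t^n = 2^{-\mu}\,\Gamma(1-\mu)\,U^{-\nu+\mu-1}R^{\nu+\mu}\left[(z^2-1)^{\mu/2}P_\nu^\mu(z)\right]\Big|_{z=\frac{R^2+u(x-t)t}{UR}}.$$ Moreover, $$\sum_{n=0}^\infty {}_2F_1(-n,\,\tfrac12;\,1-2\mu;\,u)\,C_n^{1/2-\mu}(x)\,t^n = 2^{-\mu}\,\Gamma(1-\mu)\,U^{-2\mu}\left[R^2+u(x-t)t\right]^{2\mu-1/2}\left[(z^2-1)^{\mu/2}P_{-1/4}^\mu(z)\right]\Big|_{z=2\left[\frac{UR}{R^2+u(x-t)t}\right]^2-1}.$$ These are equalities between power series in $t$, convergent for all sufficiently small complex $t$. Here $z=1$ at $t=0$, and the bracket, as a power series in $t$, is understood through its germ at $z=1$: there is a function analytic at $z=1$ that, near $z=1$, equals $(z^2-1)^{\mu/2}P_\nu^\mu(z)$ on $\mathbb{C}\setminus(-\infty,1]$ and $(1-z^2)^{\mu/2}\mathrm{P}_\nu^\mu(z)$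 on $\mathbb{C}\setminus\big((-\infty,-1]\cup[1,\infty)\big)$ (with $\nu=-1/4$ in the second formula). In particular, for all sufficiently small $t$ the formulas hold as displayed whenever $z\notin(-\infty,1]$ (for real $z$: when $z>1$), and they hold with $P$ and $z^2-1$ replaced by $\mathrm{P}$ and $1-z^2$ whenever $z\notin(-\infty,-1]\cup[1,\infty)$ (for real $z$: when $-1<z<1$). -/

import Mathlib

open Filter Topology

noncomputable section

/-- The Gegenbauer polynomial `C_n^lam(x)`: the coefficient of `t^n` in the Taylor expansion
of `(1 - 2xt + t²)^(-lam)` at `t = 0` (the branch equal to `1` at `t = 0`). -/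
def gegenbauerC (lam : ℂ) (n : ℕ) (x : ℂ) : ℂ :=
  iteratedDeriv n (fun t : ℂ => (1 - 2 * x * t + t ^ 2) ^ (-lam)) 0 / (n.factorial : ℂ)

/-- The Gauss function `₂F₁(a, b; c; w)` on the plane cut along `[1, ∞)`: the hypergeometric
series in the open unit disk, and elsewhere the analytic continuation of its sum to the
cut plane (which exists and is unique when `c` is not a nonpositive integer). -/
def gaussF (a b c w : ℂ) : ℂ :=
  open Classical in
  if ‖w‖ < 1 then ordinaryHypergeometric a b c w
  else if h : ∃ F : ℂ → ℂ, AnalyticOnNhd ℂ F {v : ℂ | ¬ (v.im = 0 ∧ 1 ≤ v.re)} ∧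
      ∀ v : ℂ, ‖v‖ < 1 → F v = ordinaryHypergeometric a b c v
    then h.choose w
    else 0

/-- The plane cut along `(-∞, 1]`, the domain of the Legendre function. -/
def legendreDomain : Set ℂ := {z : ℂ | ¬ (z.im = 0 ∧ z.re ≤ 1)}

/-- The plane cut along `(-∞, -1]` and `[1, ∞)`, the domain of the Ferrers function. -/
def ferrersDomain : Set ℂ := {z : ℂ | ¬ (z.im = 0 ∧ (z.re ≤ -1 ∨ 1 ≤ z.re))}

/-- The power `(z² - 1)^a`, in the branch that is analytic on the plane cut along `(-∞, 1]`
and has its principal value for real `z > 1`. -/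
def sqSubOnePow (z a : ℂ) : ℂ := (z - 1) ^ a * (z + 1) ^ a

/-- The power `(1 - z²)^a`; the principal branch is analytic on the plane cut along
`(-∞, -1]` and `[1, ∞)`. -/
def oneSubSqPow (z a : ℂ) : ℂ := (1 - z ^ 2) ^ a

/-- The associated Legendre function `P_ν^μ(z)` of degree `ν` and order `μ`, for
`z ∈ legendreDomain` and `μ ≠ 1, 2, 3, …`. -/
def legendreP (ν μ z : ℂ) : ℂ :=
  2 ^ μ / Complex.Gamma (1 - μ) * sqSubOnePow z (-μ / 2) *
    gaussF (-ν - μ) (1 + ν - μ) (1 - μ) ((1 - z) / 2)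

/-- The Ferrers function (Legendre function on the cut) of degree `ν` and order `μ`, for
`z ∈ ferrersDomain` and `μ ≠ 1, 2, 3, …`. -/
def ferrersP (ν μ z : ℂ) : ℂ :=
  2 ^ μ / Complex.Gamma (1 - μ) * oneSubSqPow z (-μ / 2) *
    gaussF (-ν - μ) (1 + ν - μ) (1 - μ) ((1 - z) / 2)

/-- `R = (1 - 2xt + t²)^(1/2)`, with `R = 1` when `t = 0`. -/
def genR (x t : ℂ) : ℂ := (1 - 2 * x * t + t ^ 2) ^ (1 / 2 : ℂ)

/-- `U = (1 - 2(1 - u)xt + (1 - u)²t²)^(1/2)`, with `U = 1` when `t = 0`. -/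
def genU (u x t : ℂ) : ℂ := (1 - 2 * (1 - u) * x * t + (1 - u) ^ 2 * t ^ 2) ^ (1 / 2 : ℂ)

/-- `R² + u(x - t)t`. -/
def genV (u x t : ℂ) : ℂ := genR x t ^ 2 + u * (x - t) * t

/-- `F` represents the germ at `z = 1` of `(z² - 1)^(μ/2) P_ν^μ(z)`: it is analytic at `z = 1`,
and near `z = 1` it agrees with `(z² - 1)^(μ/2) P_ν^μ(z)` on the Legendre domain and with
`(1 - z²)^(μ/2)` times the Ferrers function on the Ferrers domain. -/
structure IsLegendreGerm (ν μ : ℂ) (F : ℂ → ℂ) : Prop where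
  analyticAt : AnalyticAt ℂ F 1
  legendre : ∀ᶠ z in 𝓝 (1 : ℂ), z ∈ legendreDomain →
    F z = sqSubOnePow z (μ / 2) * legendreP ν μ z
  ferrers : ∀ᶠ z in 𝓝 (1 : ℂ), z ∈ ferrersDomain →
    F z = oneSubSqPow z (μ / 2) * ferrersP ν μ z

/-- The identity `∑ c_n t^n = A(t) [(z² - 1)^(μ/2) P_ν^μ(z)]` at `z = z(t)`, where `z(0) = 1`,
between convergent power series in `t`. The bracket stands for its analytic germ at `z = 1`;
for small `t` the identity holds literally, with the Legendre function when `z(t)` lies in the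
Legendre domain (for real `z`: when `z > 1`), and with the Ferrers function and `1 - z²` when
`z(t)` lies in the Ferrers domain (for real `z`: when `-1 < z < 1`). -/
def LegendreGenerating (c : ℕ → ℂ) (A : ℂ → ℂ) (ν μ : ℂ) (z : ℂ → ℂ) : Prop :=
  (∃ F : ℂ → ℂ, IsLegendreGerm ν μ F ∧
    ∀ᶠ t in 𝓝 (0 : ℂ), HasSum (fun n : ℕ => c n * t ^ n) (A t * F (z t))) ∧
  (∀ᶠ t in 𝓝 (0 : ℂ), z t ∈ legendreDomain →
    HasSum (fun n : ℕ => c n * t ^ n)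
      (A t * (sqSubOnePow (z t) (μ / 2) * legendreP ν μ (z t)))) ∧
  (∀ᶠ t in 𝓝 (0 : ℂ), z t ∈ ferrersDomain →
    HasSum (fun n : ℕ => c n * t ^ n)
      (A t * (oneSubSqPow (z t) (μ / 2) * ferrersP ν μ (z t))))

end

/-! Put `lam = 1/2 - μ` and `c = 2 * lam = 1 - 2μ`. The excluded values of `μ` are exactly those
making `c` a nonpositive integer. Let L be the linear functional with moments L[s^k] = (b)_k/(c)_k:
Euler's beta integral where that converges, realised here for all complex `b` as a contour integral
over |s| = 2. Since L[(1 - us)^n] = ₂F₁(-n, b; c; u), applying L to the Gegenbauer generating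
function at t(1 - us) turns the left side into L[Q(s)^(-lam)], with Q(s) = R²(1-s)² + 2V s(1-s) +
U²s² and V = R² + u(x-t)t.

The key evaluation is L[s^k (1-s)^l (P(1-s) + Ss)^(-(c+k+l))], a Pochhammer quotient times powers of
P and S (`betaFunctional_pow_mul_segment_cpow`). It applies because Q is a quadratic form in (1-s,
s) and c is twice the exponent. Two ways of completing the square, followed by a binomial expansion,
give the two formulas: Q = (R(1-s) + Us)² + 2(V - UR)s(1-s) and U²Q = (V(1-s) + U²s)² + (U²R² -
V²)(1-s)². The duplication formula for (2 lam)_{2m} makes each resulting series a ₂F₁, which is the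
Legendre function stripped of its power factor. -/

/-! ### Pochhammer symbols, hypergeometric and binomial series -/

open Polynomial in
theorem ascPochhammer_eval_succ_left (n : ℕ) (a : ℂ) :
    (ascPochhammer ℂ (n + 1)).eval a = a * (ascPochhammer ℂ n).eval (a + 1) := by
  simp [ascPochhammer_succ_left, eval_comp]

open Polynomial in
theorem ascPochhammer_eval_add (m n : ℕ) (a : ℂ) :
    (ascPochhammer ℂ (m + n)).eval a =
      (ascPochhammer ℂ m).eval a * (ascPochhammer ℂ n).eval (a + m) := by
  simp [← ascPochhammer_mul, eval_comp]

theorem ascPochhammer_eval_two_mul (m : ℕ) (a : ℂ) :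
    (ascPochhammer ℂ (2 * m)).eval (2 * a) =
      4 ^ m * (ascPochhammer ℂ m).eval a * (ascPochhammer ℂ m).eval (a + 1 / 2) := by
  induction m with
  | zero => simp
  | succ m ih =>
    rw [show 2 * (m + 1) = 2 * m + 1 + 1 by ring, ascPochhammer_succ_eval,
      ascPochhammer_succ_eval, ih, ascPochhammer_succ_eval, ascPochhammer_succ_eval]
    push_cast
    ring

theorem ascPochhammer_eval_ne_zero {a : ℂ} (h : ∀ k : ℕ, a ≠ -k) (n : ℕ) :
    (ascPochhammer ℂ n).eval a ≠ 0 := by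
  rw [Ne, ascPochhammer_eval_eq_zero_iff]
  rintro ⟨k, -, hk⟩
  exact h k (by rw [hk, neg_neg])

/-- In the exceptional cases the series terminates, even when `c` is a nonpositive integer, because
the inverse of zero is zero. The radius is then infinite. -/
theorem one_le_radius_ordinaryHypergeometricSeries (a b c : ℂ) :
    1 ≤ (ordinaryHypergeometricSeries ℂ a b c).radius := by
  by_cases h : ∀ k : ℕ, (k : ℂ) ≠ -a ∧ (k : ℂ) ≠ -b ∧ (k : ℂ) ≠ -c
  · rw [ordinaryHypergeometricSeries_radius_eq_one ℂ a b c h]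
  · have : ∃ k : ℕ, a = -k ∨ b = -k ∨ c = -k := by
      push Not at h
      obtain ⟨k, hk⟩ := h
      refine ⟨k, ?_⟩
      by_contra hc
      push Not at hc
      have h1 : (k : ℂ) ≠ -a := fun h => hc.1 (by rw [h, neg_neg])
      have h2 : (k : ℂ) ≠ -b := fun h => hc.2.1 (by rw [h, neg_neg])
      exact hc.2.2 (by rw [hk h1 h2, neg_neg])
    obtain ⟨k, rfl | rfl | rfl⟩ := this
    · simp [ordinaryHypergeometric_radius_top_of_neg_nat₁]
    · simp [ordinaryHypergeometric_radius_top_of_neg_nat₂]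
    · simp [ordinaryHypergeometric_radius_top_of_neg_nat₃]

theorem analyticAt_ordinaryHypergeometric_zero (a b c : ℂ) :
    AnalyticAt ℂ (ordinaryHypergeometric a b c : ℂ → ℂ) 0 :=
  ((ordinaryHypergeometricSeries ℂ a b c).hasFPowerSeriesOnBall
    (zero_lt_one.trans_le (one_le_radius_ordinaryHypergeometricSeries a b c))).analyticAt

theorem hasSum_ordinaryHypergeometric (a b c : ℂ) {w : ℂ} (hw : ‖w‖ < 1) :
    HasSum (fun n => ordinaryHypergeometricCoefficient a b c n * w ^ n)
      (ordinaryHypergeometric a b c w) := by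
  have h := (ordinaryHypergeometricSeries ℂ a b c).hasSum (x := w) (by
    refine Metric.eball_subset_eball (one_le_radius_ordinaryHypergeometricSeries a b c) ?_
    simpa [Metric.mem_eball, edist_zero_right, enorm_eq_nnnorm, ← NNReal.coe_lt_one] using hw)
  simp only [ordinaryHypergeometricSeries_apply_eq, smul_eq_mul] at h
  exact h

theorem ordinaryHypergeometric_eq_of_hasSum {a b c w y : ℂ}
    (h : HasSum (fun n => ordinaryHypergeometricCoefficient a b c n * w ^ n) y) :
    ordinaryHypergeometric a b c w = y := by
  rw [ordinaryHypergeometric_eq_tsum]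
  exact h.tsum_eq

theorem hasSum_one_sub_cpow_neg (a : ℂ) {x : ℂ} (hx : ‖x‖ < 1) :
    HasSum (fun n : ℕ => (n.factorial : ℂ)⁻¹ * (ascPochhammer ℂ n).eval a * x ^ n)
      ((1 - x) ^ (-a)) := by
  have h := (Complex.one_add_cpow_hasFPowerSeriesOnBall_zero (a := -a)).hasSum (y := -x) (by
    simpa [Metric.mem_eball, edist_zero_right, enorm_eq_nnnorm, ← NNReal.coe_lt_one] using hx)
  rw [binomialSeries_eq_ordinaryHypergeometricSeries (b := 1)
    (fun k hk => by
      have : ((k + 1 : ℕ) : ℂ) = 0 := by push_cast; rw [hk]; ring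
      exact absurd this (Nat.cast_ne_zero.2 (Nat.succ_ne_zero k)))] at h
  rw [zero_add, ← sub_eq_add_neg] at h
  refine Eq.subst (motive := fun f : ℕ → ℂ => HasSum f ((1 - x) ^ (-a))) (funext fun n => ?_) h
  have h1 : (ascPochhammer ℂ n).eval 1 ≠ 0 := by
    rw [ascPochhammer_eval_one]; exact Nat.cast_ne_zero.2 n.factorial_ne_zero
  have h2 : ((ordinaryHypergeometricSeries ℂ (- -a) 1 1).compContinuousLinearMap
      (-(ContinuousLinearMap.id ℂ ℂ)) n fun _ => -x) =
      ordinaryHypergeometricSeries ℂ (- -a) 1 1 n fun _ => x := by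
    rw [FormalMultilinearSeries.compContinuousLinearMap_apply]
    congr 1
    ext i
    simp
  rw [h2, ordinaryHypergeometricSeries_apply_eq, neg_neg, smul_eq_mul, mul_inv_cancel_right₀ h1]

/-! ### Principal powers on the right half-plane -/

theorem Complex.mul_cpow_of_re_pos {a b : ℂ} (ha : 0 < a.re) (hb : 0 < b.re) (p : ℂ) :
    (a * b) ^ p = a ^ p * b ^ p := by
  have ha0 : a ≠ 0 := by rintro rfl; simp at ha
  have hb0 : b ≠ 0 := by rintro rfl; simp at hb
  have h1 := abs_lt.1 (Complex.abs_arg_lt_pi_div_two_iff.2 (Or.inl ha))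
  have h2 := abs_lt.1 (Complex.abs_arg_lt_pi_div_two_iff.2 (Or.inl hb))
  rw [Complex.cpow_def_of_ne_zero (mul_ne_zero ha0 hb0), Complex.cpow_def_of_ne_zero ha0,
    Complex.cpow_def_of_ne_zero hb0, Complex.log_mul ha0 hb0 ⟨by linarith, by linarith⟩, add_mul,
    Complex.exp_add]

theorem Complex.sq_cpow_of_re_pos {a : ℂ} (ha : 0 < a.re) (p : ℂ) : (a ^ 2) ^ p = a ^ (2 * p) := by
  have ha0 : a ≠ 0 := by rintro rfl; simp at ha
  rw [sq, Complex.mul_cpow_of_re_pos ha ha, ← Complex.cpow_add _ _ ha0, two_mul]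

theorem Complex.re_pos_of_norm_sub_one_lt {a : ℂ} (h : ‖a - 1‖ < 1) : 0 < a.re := by
  have := (Complex.abs_re_le_norm (a - 1)).trans_lt h
  rw [abs_lt, Complex.sub_re, Complex.one_re] at this
  linarith [this.1]

/-! ### The beta functional as a contour integral -/

/-- The moments `(b)_k / (c)_k`. -/
noncomputable def betaMoment (b c : ℂ) (k : ℕ) : ℂ :=
  (ascPochhammer ℂ k).eval b * ((ascPochhammer ℂ k).eval c)⁻¹

theorem betaMoment_zero (b c : ℂ) : betaMoment b c 0 = 1 := by simp [betaMoment]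

theorem betaMoment_succ (b c : ℂ) (k : ℕ) :
    betaMoment b c (k + 1) = b / c * betaMoment (b + 1) (c + 1) k := by
  simp only [betaMoment, ascPochhammer_eval_succ_left, mul_inv]
  ring

theorem betaMoment_sub_succ (b : ℂ) {c : ℂ} (hc : ∀ k : ℕ, c ≠ -k) (k : ℕ) :
    betaMoment b c k - betaMoment b c (k + 1) = (c - b) / c * betaMoment b (c + 1) k := by
  have h1 := ascPochhammer_eval_ne_zero hc k
  have h2 := ascPochhammer_eval_ne_zero hc (k + 1)
  have h3 : (ascPochhammer ℂ (k + 1)).eval c = (ascPochhammer ℂ k).eval c * (c + k) :=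
    ascPochhammer_succ_eval _ _
  have h4 := ascPochhammer_eval_succ_left k c
  have hc0 : c ≠ 0 := by simpa using hc 0
  have h5 : (ascPochhammer ℂ k).eval (c + 1) ≠ 0 := fun h => h2 (by rw [h4, h, mul_zero])
  have h6 : c + k ≠ 0 := fun h => h2 (by rw [h3, h, mul_zero])
  have h7 : (ascPochhammer ℂ k).eval (c + 1) = (ascPochhammer ℂ k).eval c * (c + k) / c := by
    rw [← h3, h4]; field_simp
  simp only [betaMoment, h3, h7, ascPochhammer_succ_eval]
  field_simp
  ring

theorem summable_betaMoment (b c : ℂ) {w : ℂ} (hw : ‖w‖ < 1) :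
    Summable fun k => betaMoment b c k * w ^ k := by
  refine (hasSum_ordinaryHypergeometric 1 b c hw).summable.congr fun k => ?_
  have : (k.factorial : ℂ) ≠ 0 := Nat.cast_ne_zero.2 k.factorial_ne_zero
  simp only [ordinaryHypergeometricCoefficient, betaMoment, ascPochhammer_eval_one]
  field_simp

/-- The kernel `∑ (b)_k / (c)_k s^(-k-1)` representing the moments `(b)_k / (c)_k`. -/
noncomputable def betaKernel (b c s : ℂ) : ℂ := ∑' k : ℕ, betaMoment b c k * s⁻¹ ^ (k + 1)

theorem norm_inv_of_mem_sphere {s : ℂ} (hs : s ∈ Metric.sphere (0 : ℂ) 2) : ‖s⁻¹‖ = 1 / 2 := by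
  rw [norm_inv, mem_sphere_zero_iff_norm.1 hs]; norm_num

theorem ne_zero_of_mem_sphere_two {s : ℂ} (hs : s ∈ Metric.sphere (0 : ℂ) 2) : s ≠ 0 := by
  rintro rfl; simp at hs

theorem summable_betaKernel (b c : ℂ) {s : ℂ} (hs : s ∈ Metric.sphere (0 : ℂ) 2) :
    Summable fun k => betaMoment b c k * s⁻¹ ^ (k + 1) := by
  refine ((summable_betaMoment b c (w := s⁻¹) ?_).mul_right s⁻¹).congr fun k => by ring
  rw [norm_inv_of_mem_sphere hs]; norm_num

theorem summable_norm_betaMoment (b c : ℂ) :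
    Summable fun k : ℕ => ‖betaMoment b c k‖ * (1 / 2 : ℝ) ^ (k + 1) := by
  refine (summable_betaKernel b c (s := 2) (by simp)).norm.congr fun k => ?_
  simp

theorem continuousOn_betaKernel (b c : ℂ) :
    ContinuousOn (betaKernel b c) (Metric.sphere 0 2) := by
  refine continuousOn_tsum (fun k => ?_) (summable_norm_betaMoment b c) fun k s hs => ?_
  · exact continuousOn_const.mul
      ((continuousOn_id.inv₀ fun s hs => ne_zero_of_mem_sphere_two hs).pow _)
  · rw [norm_mul, norm_pow, norm_inv_of_mem_sphere hs]

/-- Multiplication by s shifts the moments. The leftover 1 is entire, so Cauchy's theorem removes it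
once paired with a holomorphic function; the same holds for the constant in
`one_sub_mul_betaKernel`. -/
theorem mul_betaKernel (b c : ℂ) {s : ℂ} (hs : s ∈ Metric.sphere (0 : ℂ) 2) :
    s * betaKernel b c s = 1 + b / c * betaKernel (b + 1) (c + 1) s := by
  have h0 := ne_zero_of_mem_sphere_two hs
  rw [betaKernel, (summable_betaKernel b c hs).tsum_eq_zero_add, mul_add, betaKernel,
    ← tsum_mul_left, ← tsum_mul_left]
  congr 1
  · simp [betaMoment_zero, h0]
  · refine tsum_congr fun k => ?_
    rw [betaMoment_succ, pow_succ s⁻¹ (k + 1)]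
    field_simp

theorem one_sub_mul_betaKernel (b : ℂ) {c : ℂ} (hc : ∀ k : ℕ, c ≠ -k) {s : ℂ}
    (hs : s ∈ Metric.sphere (0 : ℂ) 2) :
    (1 - s) * betaKernel b c s = (c - b) / c * betaKernel b (c + 1) s - 1 := by
  have h1 : betaKernel b c s - b / c * betaKernel (b + 1) (c + 1) s =
      (c - b) / c * betaKernel b (c + 1) s := by
    simp only [betaKernel, ← tsum_mul_left]
    rw [← (summable_betaKernel b c hs).tsum_sub
      ((summable_betaKernel (b + 1) (c + 1) hs).mul_left _)]
    refine tsum_congr fun k => ?_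
    rw [← mul_assoc, ← betaMoment_succ, ← mul_assoc, ← betaMoment_sub_succ b hc, sub_mul]
  rw [sub_mul, mul_betaKernel b c hs, ← h1]
  ring

/-- The functional `s^k ↦ (b)_k / (c)_k` on functions holomorphic near the disk `‖s‖ ≤ 2`. -/
noncomputable def betaFunctional (b c : ℂ) (f : ℂ → ℂ) : ℂ :=
  (2 * Real.pi * Complex.I)⁻¹ * ∮ s in C(0, 2), betaKernel b c s * f s

theorem betaFunctional_congr (b c : ℂ) {f g : ℂ → ℂ}
    (h : ∀ s ∈ Metric.sphere (0 : ℂ) 2, f s = g s) :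
    betaFunctional b c f = betaFunctional b c g := by
  rw [betaFunctional, betaFunctional, circleIntegral.integral_congr zero_le_two]
  intro s hs
  simp only [h s hs]

theorem betaFunctional_const_mul (b c a : ℂ) (f : ℂ → ℂ) :
    betaFunctional b c (fun s => a * f s) = a * betaFunctional b c f := by
  simp only [betaFunctional, mul_left_comm _ a, circleIntegral.integral_const_mul]

theorem hasSum_circleIntegral {F : ℕ → ℂ → ℂ} {f : ℂ → ℂ} {B : ℕ → ℝ}
    (hF : ∀ n, ContinuousOn (F n) (Metric.sphere 0 2)) (hB : Summable B)
    (hFB : ∀ n, ∀ s ∈ Metric.sphere (0 : ℂ) 2, ‖F n s‖ ≤ B n)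
    (hf : ∀ s ∈ Metric.sphere (0 : ℂ) 2, HasSum (fun n => F n s) (f s)) :
    HasSum (fun n => ∮ s in C(0, 2), F n s) (∮ s in C(0, 2), f s) := by
  have hmem : ∀ θ, circleMap 0 2 θ ∈ Metric.sphere (0 : ℂ) 2 :=
    circleMap_mem_sphere 0 zero_le_two
  refine intervalIntegral.hasSum_integral_of_dominated_convergence (fun n _ => 2 * B n)
    (fun n => ?_) (fun n => ?_) ?_ (by simp) ?_
  · have h1 : Continuous (deriv (circleMap 0 2)) := by
      rw [funext (deriv_circleMap 0 2)]; fun_prop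
    have h2 : Continuous fun θ => F n (circleMap 0 2 θ) :=
      (hF n).comp_continuous (continuous_circleMap 0 2) hmem
    exact (h1.smul h2).aestronglyMeasurable
  · refine Eventually.of_forall fun θ _ => ?_
    rw [norm_smul]
    gcongr
    · simp
    · exact hFB n _ (hmem θ)
  · exact Eventually.of_forall fun θ _ => hB.mul_left 2
  · exact Eventually.of_forall fun θ _ => (hf _ (hmem θ)).const_smul _

theorem hasSum_betaFunctional (b c : ℂ) {F : ℕ → ℂ → ℂ} {f : ℂ → ℂ} {B : ℕ → ℝ}
    (hF : ∀ n, ContinuousOn (F n) (Metric.sphere 0 2)) (hB : Summable B)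
    (hFB : ∀ n, ∀ s ∈ Metric.sphere (0 : ℂ) 2, ‖F n s‖ ≤ B n)
    (hf : ∀ s ∈ Metric.sphere (0 : ℂ) 2, HasSum (fun n => F n s) (f s)) :
    HasSum (fun n => betaFunctional b c (F n)) (betaFunctional b c f) := by
  obtain ⟨M, hM⟩ := (isCompact_sphere (0 : ℂ) 2).exists_bound_of_continuousOn
    (continuousOn_betaKernel b c)
  refine (hasSum_circleIntegral (B := fun n => M * B n)
    (fun n => (continuousOn_betaKernel b c).mul (hF n)) (hB.mul_left M) (fun n s hs => ?_)
    (fun s hs => (hf s hs).mul_left _)).mul_left _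
  rw [Pi.mul_apply, norm_mul]
  exact mul_le_mul (hM s hs) (hFB n s hs) (norm_nonneg _) ((norm_nonneg _).trans (hM s hs))

theorem circleIntegrable_const_mul_betaKernel_mul (a b c : ℂ) {f : ℂ → ℂ}
    (hf : DifferentiableOn ℂ f (Metric.closedBall 0 2)) :
    CircleIntegrable (fun s => a * (betaKernel b c s * f s)) 0 2 :=
  (continuousOn_const.mul ((continuousOn_betaKernel b c).mul
    (hf.continuousOn.mono Metric.sphere_subset_closedBall))).circleIntegrable zero_le_two

theorem circleIntegral_eq_zero_of_differentiableOn {f : ℂ → ℂ}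
    (hf : DifferentiableOn ℂ f (Metric.closedBall 0 2)) : (∮ s in C(0, 2), f s) = 0 := by
  refine DiffContOnCl.circleIntegral_eq_zero zero_le_two
    (DifferentiableOn.diffContOnCl (hf.mono ?_))
  rw [closure_ball _ two_ne_zero]

theorem betaFunctional_id_mul (b c : ℂ) {f : ℂ → ℂ}
    (hf : DifferentiableOn ℂ f (Metric.closedBall 0 2)) :
    betaFunctional b c (fun s => s * f s) = b / c * betaFunctional (b + 1) (c + 1) f := by
  have h : (∮ s in C(0, 2), betaKernel b c s * (s * f s)) =
      ∮ s in C(0, 2), (f s + b / c * (betaKernel (b + 1) (c + 1) s * f s)) := by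
    refine circleIntegral.integral_congr zero_le_two fun s hs => ?_
    linear_combination f s * mul_betaKernel b c hs
  rw [betaFunctional, h, circleIntegral.integral_add
    ((hf.continuousOn.mono Metric.sphere_subset_closedBall).circleIntegrable zero_le_two)
    (circleIntegrable_const_mul_betaKernel_mul _ _ _ hf),
    circleIntegral_eq_zero_of_differentiableOn hf, circleIntegral.integral_const_mul,
    betaFunctional]
  ring

theorem betaFunctional_one_sub_mul (b : ℂ) {c : ℂ} (hc : ∀ k : ℕ, c ≠ -k) {f : ℂ → ℂ}
    (hf : DifferentiableOn ℂ f (Metric.closedBall 0 2)) :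
    betaFunctional b c (fun s => (1 - s) * f s) = (c - b) / c * betaFunctional b (c + 1) f := by
  have h : (∮ s in C(0, 2), betaKernel b c s * ((1 - s) * f s)) =
      ∮ s in C(0, 2), ((c - b) / c * (betaKernel b (c + 1) s * f s) - f s) := by
    refine circleIntegral.integral_congr zero_le_two fun s hs => ?_
    linear_combination f s * one_sub_mul_betaKernel b hc hs
  rw [betaFunctional, h, circleIntegral.integral_sub
    (circleIntegrable_const_mul_betaKernel_mul _ _ _ hf)
    ((hf.continuousOn.mono Metric.sphere_subset_closedBall).circleIntegrable zero_le_two),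
    circleIntegral_eq_zero_of_differentiableOn hf, circleIntegral.integral_const_mul,
    betaFunctional]
  ring

theorem betaFunctional_pow_mul {f : ℂ → ℂ} (hf : DifferentiableOn ℂ f (Metric.closedBall 0 2))
    (k : ℕ) (b c : ℂ) :
    betaFunctional b c (fun s => s ^ k * f s) =
      betaMoment b c k * betaFunctional (b + k) (c + k) f := by
  induction k generalizing b c with
  | zero => simp [betaMoment_zero]
  | succ k ih =>
    have h := betaFunctional_id_mul b c (f := fun s => s ^ k * f s) (by fun_prop)
    rw [ih] at h
    simp only [pow_succ', mul_assoc]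
    rw [h, betaMoment_succ, mul_assoc]
    push_cast
    congr 3 <;> ring

theorem forall_add_ne_neg {c : ℂ} (hc : ∀ k : ℕ, c ≠ -k) (j : ℕ) : ∀ k : ℕ, c + j ≠ -k := by
  intro k h
  refine hc (j + k) ?_
  push_cast
  linear_combination h

theorem betaFunctional_one_sub_pow_mul {f : ℂ → ℂ}
    (hf : DifferentiableOn ℂ f (Metric.closedBall 0 2)) (k : ℕ) (b : ℂ) {c : ℂ}
    (hc : ∀ k : ℕ, c ≠ -k) :
    betaFunctional b c (fun s => (1 - s) ^ k * f s) =
      betaMoment (c - b) c k * betaFunctional b (c + k) f := by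
  induction k generalizing c with
  | zero => simp [betaMoment_zero]
  | succ k ih =>
    have h := betaFunctional_one_sub_mul b hc (f := fun s => (1 - s) ^ k * f s) (by fun_prop)
    rw [ih (by simpa using forall_add_ne_neg hc 1)] at h
    simp only [pow_succ', mul_assoc]
    rw [h, betaMoment_succ, mul_assoc]
    push_cast
    congr 3 <;> ring

/-- Integrating the kernel termwise, only the k = 0 term has a residue. -/
theorem betaFunctional_one (b c : ℂ) : betaFunctional b c (fun _ => 1) = 1 := by
  have h : HasSum (fun k : ℕ => ∮ s in C(0, 2), betaMoment b c k * s⁻¹ ^ (k + 1))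
      (∮ s in C(0, 2), betaKernel b c s) := by
    refine hasSum_circleIntegral (fun k => ?_) (summable_norm_betaMoment b c) (fun k s hs => ?_)
      fun s hs => (summable_betaKernel b c hs).hasSum
    · exact continuousOn_const.mul
        ((continuousOn_id.inv₀ fun s hs => ne_zero_of_mem_sphere_two hs).pow _)
    · rw [norm_mul, norm_pow, norm_inv_of_mem_sphere hs]
  have h2 : (∮ s in C(0, 2), betaKernel b c s) = 2 * Real.pi * Complex.I := by
    refine (h.unique (hasSum_single 0 fun k hk => ?_)).trans ?_
    · rw [circleIntegral.integral_const_mul]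
      have := circleIntegral.integral_sub_zpow_of_ne (n := -((k + 1 : ℕ) : ℤ)) (by omega) 0 0 2
      simp only [sub_zero, zpow_neg, zpow_natCast] at this
      simp only [inv_pow, this, mul_zero]
    · have := circleIntegral.integral_sub_center_inv 0 (R := 2) two_ne_zero
      simpa [betaMoment_zero] using this
  simp only [betaFunctional, mul_one, h2]
  exact inv_mul_cancel₀ Complex.two_pi_I_ne_zero

theorem betaFunctional_pow (b c : ℂ) (k : ℕ) :
    betaFunctional b c (fun s => s ^ k) = betaMoment b c k := by
  simpa [betaFunctional_one] using
    betaFunctional_pow_mul (f := fun _ => 1) (differentiableOn_const _) k b c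

/-! ### Beta integrals of powers of P(1-s) + Ss -/

theorem Complex.sq_re_pos_of_norm_sub_one_le {a : ℂ} (h : ‖a - 1‖ ≤ 1 / 2) : 0 < (a ^ 2).re := by
  have h1 : ‖a - 1‖ ^ 2 ≤ (1 / 2) ^ 2 := by gcongr
  rw [Complex.sq_norm, Complex.normSq_apply, Complex.sub_re, Complex.sub_im, Complex.one_re,
    Complex.one_im, sub_zero] at h1
  rw [sq, Complex.mul_re]
  nlinarith [sq_nonneg (2 * a.re - 1)]

theorem norm_segment_sub_one_le {P S : ℂ} (hP : ‖P - 1‖ ≤ 1 / 10) (hS : ‖S - 1‖ ≤ 1 / 10) {s : ℂ}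
    (hs : ‖s‖ ≤ 2) : ‖P * (1 - s) + S * s - 1‖ ≤ 1 / 2 := by
  have h1 : ‖1 - s‖ ≤ 3 := (norm_sub_le _ _).trans (by rw [norm_one]; linarith)
  calc ‖P * (1 - s) + S * s - 1‖ = ‖(P - 1) * (1 - s) + (S - 1) * s‖ := by congr 1; ring
    _ ≤ ‖P - 1‖ * ‖1 - s‖ + ‖S - 1‖ * ‖s‖ := by
      rw [← norm_mul, ← norm_mul]; exact norm_add_le _ _
    _ ≤ 1 / 10 * 3 + 1 / 10 * 2 := by gcongr
    _ = 1 / 2 := by norm_num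

theorem segment_re_pos {P S : ℂ} (hP : ‖P - 1‖ ≤ 1 / 10) (hS : ‖S - 1‖ ≤ 1 / 10) {s : ℂ}
    (hs : ‖s‖ ≤ 2) : 0 < (P * (1 - s) + S * s).re :=
  Complex.re_pos_of_norm_sub_one_lt
    ((norm_segment_sub_one_le hP hS hs).trans_lt (by norm_num))

theorem differentiableOn_segment_cpow {P S : ℂ} (hP : ‖P - 1‖ ≤ 1 / 10) (hS : ‖S - 1‖ ≤ 1 / 10)
    (p : ℂ) :
    DifferentiableOn ℂ (fun s => (P * (1 - s) + S * s) ^ p) (Metric.closedBall 0 2) := by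
  refine DifferentiableOn.cpow_const (by fun_prop) fun s hs => ?_
  exact Or.inl (segment_re_pos hP hS (mem_closedBall_zero_iff.1 hs))

/-- Factor the base as P(1 - ys). The binomial coefficients (c)_n/n! meet the moments (b)_n/(c)_n,
so the image is the binomial series of (1 - y)^(-b), and P(1 - y) = S. -/
theorem betaFunctional_segment_cpow_neg (b : ℂ) {c : ℂ} (hc : ∀ k : ℕ, c ≠ -k) {P S : ℂ}
    (hP : ‖P - 1‖ ≤ 1 / 10) (hS : ‖S - 1‖ ≤ 1 / 10) :
    betaFunctional b c (fun s => (P * (1 - s) + S * s) ^ (-c)) = S ^ (-b) * P ^ (b - c) := by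
  have hPre : 0 < P.re := Complex.re_pos_of_norm_sub_one_lt (hP.trans_lt (by norm_num))
  have hP0 : P ≠ 0 := by rintro rfl; simp at hPre
  have hPn : 9 / 10 ≤ ‖P‖ := by
    have := norm_sub_norm_le (1 : ℂ) (1 - P)
    rw [norm_sub_rev] at hP
    rw [norm_one, sub_sub_cancel] at this
    linarith
  set y := (P - S) / P with hy
  -- From |P - S| ≤ 1/5 and |P| ≥ 9/10; hence |ys| ≤ 4/9 on the circle and the binomial series
  -- converges uniformly there.
  have hyn : ‖y‖ ≤ 2 / 9 := by
    have : ‖P - S‖ ≤ 1 / 5 := by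
      calc ‖P - S‖ = ‖(P - 1) - (S - 1)‖ := by congr 1; ring
        _ ≤ ‖P - 1‖ + ‖S - 1‖ := norm_sub_le _ _
        _ ≤ 1 / 5 := by linarith
    rw [hy, norm_div, div_le_iff₀ (by linarith)]
    linarith
  have hys : ∀ s ∈ Metric.sphere (0 : ℂ) 2, ‖y * s‖ ≤ 4 / 9 := fun s hs => by
    rw [norm_mul, mem_sphere_zero_iff_norm.1 hs]; linarith
  have hre : ∀ w : ℂ, ‖w‖ < 1 → 0 < (1 - w).re := fun w hw =>
    Complex.re_pos_of_norm_sub_one_lt (by simpa using hw)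
  have hcongr : betaFunctional b c (fun s => (P * (1 - s) + S * s) ^ (-c)) =
      P ^ (-c) * betaFunctional b c (fun s => (1 - y * s) ^ (-c)) := by
    rw [← betaFunctional_const_mul]
    refine betaFunctional_congr b c fun s hs => ?_
    rw [← Complex.mul_cpow_of_re_pos hPre (hre _ ((hys s hs).trans_lt (by norm_num))), hy]
    congr 1
    field_simp
    ring
  have hB : Summable fun n : ℕ =>
      ‖(n.factorial : ℂ)⁻¹ * (ascPochhammer ℂ n).eval c‖ * (4 / 9 : ℝ) ^ n := by
    refine (hasSum_one_sub_cpow_neg c (x := 4 / 9) (by norm_num)).summable.norm.congr fun n => ?_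
    rw [norm_mul, norm_pow]
    norm_num
  have hsum := hasSum_betaFunctional b c
    (F := fun n s => (n.factorial : ℂ)⁻¹ * (ascPochhammer ℂ n).eval c * (y * s) ^ n)
    (fun n => by fun_prop) hB (fun n s hs => by
      rw [norm_mul, norm_pow]
      gcongr
      exact hys s hs)
    (fun s hs => hasSum_one_sub_cpow_neg c ((hys s hs).trans_lt (by norm_num)))
  have hterm : ∀ n : ℕ, betaFunctional b c
      (fun s => (n.factorial : ℂ)⁻¹ * (ascPochhammer ℂ n).eval c * (y * s) ^ n) =
      (n.factorial : ℂ)⁻¹ * (ascPochhammer ℂ n).eval b * y ^ n := by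
    intro n
    simp only [mul_pow]
    simp only [← mul_assoc, betaFunctional_const_mul, betaFunctional_pow, betaMoment]
    field_simp [ascPochhammer_eval_ne_zero hc n]
  simp only [hterm] at hsum
  have hy1 : ‖y‖ < 1 := hyn.trans_lt (by norm_num)
  rw [hcongr, hsum.unique (hasSum_one_sub_cpow_neg b hy1)]
  have hSy : S = P * (1 - y) := by rw [hy]; field_simp; ring
  rw [hSy, Complex.mul_cpow_of_re_pos hPre (hre y hy1), mul_right_comm, ← Complex.cpow_add _ _ hP0]
  congr 2
  ring

theorem betaMoment_mul_betaMoment (b c : ℂ) (k l : ℕ) :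
    betaMoment b c k * betaMoment (c - b) (c + k) l =
      (ascPochhammer ℂ k).eval b * (ascPochhammer ℂ l).eval (c - b) *
        ((ascPochhammer ℂ (k + l)).eval c)⁻¹ := by
  rw [betaMoment, betaMoment, ascPochhammer_eval_add, mul_inv]
  ring

/-- Absorbing s^k and then (1-s)^l moves the parameters to (b+k, c+k+l). The exponent is chosen to
match the new lower parameter, so `betaFunctional_segment_cpow_neg` applies. -/
theorem betaFunctional_pow_mul_segment_cpow (b : ℂ) {c : ℂ} (hc : ∀ k : ℕ, c ≠ -k) {P S : ℂ}
    (hP : ‖P - 1‖ ≤ 1 / 10) (hS : ‖S - 1‖ ≤ 1 / 10) (k l : ℕ) :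
    betaFunctional b c
        (fun s => s ^ k * ((1 - s) ^ l * (P * (1 - s) + S * s) ^ (-(c + k + l)))) =
      (ascPochhammer ℂ k).eval b * (ascPochhammer ℂ l).eval (c - b) *
        ((ascPochhammer ℂ (k + l)).eval c)⁻¹ * (S ^ (-(b + k)) * P ^ (b - c - l)) := by
  have hd := differentiableOn_segment_cpow hP hS (-(c + k + l))
  have hc' := forall_add_ne_neg hc k
  rw [betaFunctional_pow_mul (by fun_prop), betaFunctional_one_sub_pow_mul hd l _ hc',
    betaFunctional_segment_cpow_neg _ (forall_add_ne_neg hc' l) hP hS, ← mul_assoc,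
    show c + k - (b + k) = c - b by ring, betaMoment_mul_betaMoment,
    show b + k - (c + k + l) = b - c - l by ring]

/-- Binomial expansion in D. The condition i + j = 2 keeps the form homogeneous, so the m-th term
carries the exponent -(2 lam + im + jm) that the beta evaluation requires. The cases (1,1) and (0,2)
are the two completions of the square. -/
theorem hasSum_betaFunctional_segment_sq_add_cpow (b : ℂ) {lam : ℂ}
    (hc : ∀ k : ℕ, 2 * lam ≠ -k) {P S D : ℂ} (hP : ‖P - 1‖ ≤ 1 / 10) (hS : ‖S - 1‖ ≤ 1 / 10)
    (hD : ‖D‖ ≤ 1 / 100) {i j : ℕ} (hij : i + j = 2) :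
    HasSum (fun m : ℕ => (m.factorial : ℂ)⁻¹ * (ascPochhammer ℂ m).eval lam * (-D) ^ m *
        ((ascPochhammer ℂ (i * m)).eval b * (ascPochhammer ℂ (j * m)).eval (2 * lam - b) *
        ((ascPochhammer ℂ (2 * m)).eval (2 * lam))⁻¹ *
          (S ^ (-(b + (i * m : ℕ))) * P ^ (b - 2 * lam - (j * m : ℕ)))))
      (betaFunctional b (2 * lam)
        (fun s => ((P * (1 - s) + S * s) ^ 2 + D * (s ^ i * (1 - s) ^ j)) ^ (-lam))) := by
  have hlin : ∀ m : ℕ, i * m + j * m = 2 * m := fun m => by rw [← add_mul, hij]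
  have hterm := fun m : ℕ => betaFunctional_pow_mul_segment_cpow b hc hP hS (i * m) (j * m)
  simp only [hlin] at hterm
  simp only [← hterm, ← betaFunctional_const_mul]
  have hnorm : ∀ s ∈ Metric.sphere (0 : ℂ) 2, ‖s‖ ≤ 2 := fun s hs =>
    (mem_sphere_zero_iff_norm.1 hs).le
  have hcont : ∀ p : ℂ, ContinuousOn (fun s => (P * (1 - s) + S * s) ^ p) (Metric.sphere 0 2) :=
    fun p => (differentiableOn_segment_cpow hP hS p).continuousOn.mono
      Metric.sphere_subset_closedBall
  obtain ⟨M, hM⟩ := (isCompact_sphere (0 : ℂ) 2).exists_bound_of_continuousOn (hcont (-(2 * lam)))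
  -- The numerator is at most 9/100, while the segment lies within 1/2 of 1, so its square has norm
  -- at least 1/4.
  have hX : ∀ s ∈ Metric.sphere (0 : ℂ) 2,
      ‖-D * (s ^ i * (1 - s) ^ j) / (P * (1 - s) + S * s) ^ 2‖ ≤ 1 / 2 := by
    intro s hs
    have h1 := norm_segment_sub_one_le hP hS (hnorm s hs)
    have h2 : 1 / 2 ≤ ‖P * (1 - s) + S * s‖ := by
      have := norm_sub_norm_le (1 : ℂ) (1 - (P * (1 - s) + S * s))
      rw [norm_sub_rev] at h1
      rw [norm_one, sub_sub_cancel] at this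
      linarith
    have h3 : ‖1 - s‖ ≤ 3 :=
      (norm_sub_le _ _).trans (by rw [norm_one]; linarith [hnorm s hs])
    have h4 : ‖s‖ ^ i * ‖1 - s‖ ^ j ≤ 9 := by
      calc ‖s‖ ^ i * ‖1 - s‖ ^ j ≤ 3 ^ i * 3 ^ j := by
            gcongr
            linarith [hnorm s hs]
        _ = 9 := by rw [← pow_add, hij]; norm_num
    have h5 : (1 / 2 : ℝ) ^ 2 ≤ ‖P * (1 - s) + S * s‖ ^ 2 := by gcongr
    rw [norm_div, norm_mul, norm_neg, norm_mul, norm_pow, norm_pow, norm_pow,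
      div_le_iff₀ (lt_of_lt_of_le (by norm_num) h5)]
    calc ‖D‖ * (‖s‖ ^ i * ‖1 - s‖ ^ j) ≤ 1 / 100 * 9 := by gcongr
      _ ≤ 1 / 2 * ‖P * (1 - s) + S * s‖ ^ 2 := by linarith
  have hpt : ∀ m : ℕ, ∀ s ∈ Metric.sphere (0 : ℂ) 2,
      (m.factorial : ℂ)⁻¹ * (ascPochhammer ℂ m).eval lam * (-D) ^ m * (s ^ (i * m) *
        ((1 - s) ^ (j * m) *
          (P * (1 - s) + S * s) ^ (-(2 * lam + (i * m : ℕ) + (j * m : ℕ))))) =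
      (P * (1 - s) + S * s) ^ (-(2 * lam)) *
        ((m.factorial : ℂ)⁻¹ * (ascPochhammer ℂ m).eval lam *
          (-D * (s ^ i * (1 - s) ^ j) / (P * (1 - s) + S * s) ^ 2) ^ m) := by
    intro m s hs
    have hre := segment_re_pos hP hS (hnorm s hs)
    have h0 : P * (1 - s) + S * s ≠ 0 := by intro h; simp [h] at hre
    rw [show -(2 * lam + (i * m : ℕ) + (j * m : ℕ)) = -(2 * lam) - (2 * m : ℕ) by
      rw [← hlin]; push_cast; ring, Complex.cpow_sub _ _ h0, Complex.cpow_natCast, pow_mul, pow_mul,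
      pow_mul, div_pow, mul_pow, mul_pow]
    ring
  have hB : Summable fun m : ℕ =>
      M * (‖(m.factorial : ℂ)⁻¹ * (ascPochhammer ℂ m).eval lam‖ * (1 / 2 : ℝ) ^ m) := by
    refine Summable.mul_left M ?_
    refine (hasSum_one_sub_cpow_neg lam (x := 1 / 2) (by norm_num)).summable.norm.congr
      fun n => ?_
    rw [norm_mul, norm_pow]
    norm_num
  refine hasSum_betaFunctional b (2 * lam) (fun m => ?_) hB (fun m s hs => ?_) fun s hs => ?_
  · have := hcont (-(2 * lam + (i * m : ℕ) + (j * m : ℕ)))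
    fun_prop
  · rw [hpt m s hs, norm_mul, norm_mul _ (_ ^ m), norm_pow]
    have h1 := hM s hs
    have h2 := hX s hs
    have : 0 ≤ M := (norm_nonneg _).trans h1
    gcongr
  · simp only [hpt _ s hs]
    have hX1 := (hX s hs).trans_lt (show (1 / 2 : ℝ) < 1 by norm_num)
    have hre := segment_re_pos hP hS (hnorm s hs)
    have h0 : P * (1 - s) + S * s ≠ 0 := by intro h; simp [h] at hre
    have hsq := Complex.sq_re_pos_of_norm_sub_one_le (norm_segment_sub_one_le hP hS (hnorm s hs))
    generalize P * (1 - s) + S * s = A at h0 hre hX1 hsq ⊢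
    have hsplit : A ^ 2 + D * (s ^ i * (1 - s) ^ j) =
        A ^ 2 * (1 - -D * (s ^ i * (1 - s) ^ j) / A ^ 2) := by
      rw [mul_sub, mul_div_cancel₀ _ (pow_ne_zero 2 h0)]
      ring
    rw [hsplit, Complex.mul_cpow_of_re_pos hsq
      (Complex.re_pos_of_norm_sub_one_lt (by simpa using hX1)), Complex.sq_cpow_of_re_pos hre,
      mul_neg]
    exact (hasSum_one_sub_cpow_neg lam hX1).mul_left _

/-! ### The generating function as a beta functional -/

theorem inv_factorial_mul_ascPochhammer_neg (n k : ℕ) :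
    (k.factorial : ℂ)⁻¹ * (ascPochhammer ℂ k).eval (-(n : ℂ)) = (-1) ^ k * (n.choose k : ℂ) := by
  have : (k.factorial : ℂ) ≠ 0 := Nat.cast_ne_zero.2 k.factorial_ne_zero
  rw [ascPochhammer_eval_neg_eq_descPochhammer, descPochhammer_eval_eq_descFactorial,
    Nat.descFactorial_eq_factorial_mul_choose]
  push_cast
  field_simp

/-- The binomial theorem has coefficients (-n)_k/k!, and the moments supply (b)_k/(c)_k. The sum is
finite, so `u` need not be small. -/
theorem betaFunctional_one_sub_mul_pow (b c u : ℂ) (n : ℕ) :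
    betaFunctional b c (fun s => (1 - u * s) ^ n) = ordinaryHypergeometric (-(n : ℂ)) b c u := by
  have hzero : ∀ k ∉ Finset.range (n + 1),
      (k.factorial : ℂ)⁻¹ * (ascPochhammer ℂ k).eval (-(n : ℂ)) = 0 := fun k hk => by
    rw [inv_factorial_mul_ascPochhammer_neg, Nat.choose_eq_zero_of_lt (by simpa using hk)]
    simp
  have hB : Summable fun k : ℕ =>
      ‖(k.factorial : ℂ)⁻¹ * (ascPochhammer ℂ k).eval (-(n : ℂ))‖ * (‖u‖ * 2) ^ k :=
    summable_of_ne_finset_zero (s := Finset.range (n + 1)) fun k hk => by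
      rw [hzero k hk, norm_zero, zero_mul]
  have h := hasSum_betaFunctional b c
    (F := fun k s => (k.factorial : ℂ)⁻¹ * (ascPochhammer ℂ k).eval (-(n : ℂ)) * (u * s) ^ k)
    (f := fun s => (1 - u * s) ^ n) (fun k => by fun_prop) hB
    (fun k s hs => by
      rw [norm_mul, norm_pow, norm_mul u, mem_sphere_zero_iff_norm.1 hs])
    (fun s hs => by
      have hs : (1 - u * s) ^ n = ∑ k ∈ Finset.range (n + 1),
          (k.factorial : ℂ)⁻¹ * (ascPochhammer ℂ k).eval (-(n : ℂ)) * (u * s) ^ k := by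
        rw [sub_eq_neg_add, add_pow]
        refine Finset.sum_congr rfl fun k _ => ?_
        rw [inv_factorial_mul_ascPochhammer_neg, neg_pow (u * s), one_pow]
        ring
      rw [hs]
      exact hasSum_sum_of_ne_finset_zero fun k hk => by rw [hzero k hk, zero_mul])
  refine (ordinaryHypergeometric_eq_of_hasSum ?_).symm
  refine Eq.subst (motive := fun f : ℕ → ℂ => HasSum f _) (funext fun k => ?_) h
  simp only [mul_pow, ← mul_assoc, betaFunctional_const_mul, betaFunctional_pow, betaMoment,
    ordinaryHypergeometricCoefficient]
  ring

theorem norm_gegenbauer_base_sub_one_lt {x w : ℂ} (hw : ‖w‖ < 1 / (2 * (‖x‖ + 1))) :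
    ‖1 - 2 * x * w + w ^ 2 - 1‖ < 1 := by
  have hx := norm_nonneg x
  rw [lt_div_iff₀ (by positivity)] at hw
  have hw2 : ‖w‖ ≤ 1 / 2 := by nlinarith [norm_nonneg w, mul_nonneg (norm_nonneg w) hx]
  calc ‖1 - 2 * x * w + w ^ 2 - 1‖ = ‖w ^ 2 - 2 * x * w‖ := by congr 1; ring
    _ ≤ ‖w ^ 2‖ + ‖2 * x * w‖ := norm_sub_le _ _
    _ = ‖w‖ ^ 2 + 2 * ‖x‖ * ‖w‖ := by simp
    _ < 1 := by nlinarith [norm_nonneg w]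

theorem hasSum_gegenbauerC (lam : ℂ) {x w : ℂ} (hw : ‖w‖ < 1 / (2 * (‖x‖ + 1))) :
    HasSum (fun n : ℕ => gegenbauerC lam n x * w ^ n) ((1 - 2 * x * w + w ^ 2) ^ (-lam)) := by
  have hd : DifferentiableOn ℂ (fun t : ℂ => (1 - 2 * x * t + t ^ 2) ^ (-lam))
      (Metric.ball 0 (1 / (2 * (‖x‖ + 1)))) := by
    refine DifferentiableOn.cpow_const (by fun_prop) fun t ht => Or.inl ?_
    exact Complex.re_pos_of_norm_sub_one_lt
      (norm_gegenbauer_base_sub_one_lt (mem_ball_zero_iff.1 ht))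
  have h := Complex.hasSum_taylorSeries_on_ball hd (z := w) (mem_ball_zero_iff.2 hw)
  refine Eq.subst (motive := fun f : ℕ → ℂ => HasSum f _) (funext fun n => ?_) h
  simp only [smul_eq_mul, sub_zero, gegenbauerC]
  ring

theorem eventually_norm_mul_one_sub_mul_lt (u : ℂ) {r : ℝ} (hr : 0 < r) :
    ∀ᶠ t in 𝓝 (0 : ℂ), ∀ s ∈ Metric.sphere (0 : ℂ) 2, ‖t * (1 - u * s)‖ ≤ r := by
  have h : Tendsto (fun t : ℂ => ‖t‖ * (1 + ‖u‖ * 2)) (𝓝 0) (𝓝 0) := by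
    have : Continuous fun t : ℂ => ‖t‖ * (1 + ‖u‖ * 2) := by fun_prop
    simpa using this.tendsto 0
  filter_upwards [h.eventually (gt_mem_nhds hr)] with t ht s hs
  rw [norm_mul]
  refine le_trans ?_ ht.le
  gcongr
  refine (norm_sub_le _ _).trans ?_
  rw [norm_one, norm_mul, mem_sphere_zero_iff_norm.1 hs]

/-- For small t the points t(1 - us), |s| = 2, stay within half the radius on which the Gegenbauer
series is known to converge; domination lets the functional pass through the sum. -/
theorem hasSum_hypergeometric_mul_gegenbauerC (b c lam u x : ℂ) :
    ∀ᶠ t in 𝓝 (0 : ℂ), HasSum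
      (fun n : ℕ => ordinaryHypergeometric (-(n : ℂ)) b c u * gegenbauerC lam n x * t ^ n)
      (betaFunctional b c
        (fun s => (1 - 2 * x * (t * (1 - u * s)) + (t * (1 - u * s)) ^ 2) ^ (-lam))) := by
  have hr : 0 < 1 / (2 * (‖x‖ + 1)) := by positivity
  filter_upwards [eventually_norm_mul_one_sub_mul_lt u (half_pos hr)] with t ht
  have hB : Summable fun n : ℕ =>
      ‖gegenbauerC lam n x‖ * (1 / (2 * (‖x‖ + 1)) / 2) ^ n := by
    refine (hasSum_gegenbauerC lam (x := x)
      (w := ((1 / (2 * (‖x‖ + 1)) / 2 : ℝ) : ℂ)) ?_).summable.norm.congr fun n => ?_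
    · rw [Complex.norm_of_nonneg (half_pos hr).le]
      exact half_lt_self hr
    · rw [norm_mul, norm_pow, Complex.norm_of_nonneg (half_pos hr).le]
  have h := hasSum_betaFunctional b c (F := fun n s => gegenbauerC lam n x * (t * (1 - u * s)) ^ n)
    (fun n => by fun_prop) hB
    (fun n s hs => by
      rw [norm_mul, norm_pow]
      gcongr
      exact ht s hs)
    (fun s hs => hasSum_gegenbauerC lam ((ht s hs).trans_lt (half_lt_self hr)))
  refine Eq.subst (motive := fun f : ℕ → ℂ => HasSum f _) (funext fun n => ?_) h
  simp only [mul_pow, ← mul_assoc, betaFunctional_const_mul, betaFunctional_one_sub_mul_pow]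
  ring

/-! ### The two completions of the square -/

theorem betaFunctional_quadratic_cpow (b : ℂ) {lam : ℂ} (hc : ∀ k : ℕ, 2 * lam ≠ -k)
    {R U V : ℂ} (hR : ‖R - 1‖ ≤ 1 / 10) (hU : ‖U - 1‖ ≤ 1 / 10)
    (hV : ‖2 * (V - U * R)‖ ≤ 1 / 100) :
    betaFunctional b (2 * lam)
        (fun s => (R ^ 2 * (1 - s) ^ 2 + 2 * V * (s * (1 - s)) + U ^ 2 * s ^ 2) ^ (-lam)) =
      U ^ (-b) * R ^ (b - 2 * lam) *
        ordinaryHypergeometric (2 * lam - b) b (lam + 1 / 2) ((1 - V / (U * R)) / 2) := by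
  have hR0 : R ≠ 0 := by rintro rfl; norm_num at hR
  have hU0 : U ≠ 0 := by rintro rfl; norm_num at hU
  have hK : U ^ (-b) * R ^ (b - 2 * lam) ≠ 0 := by simp [Complex.cpow_eq_zero_iff, hR0, hU0]
  have h := hasSum_betaFunctional_segment_sq_add_cpow b hc hR hU hV (i := 1) (j := 1) rfl
  rw [betaFunctional_congr b (2 * lam) (g := fun s =>
    ((R * (1 - s) + U * s) ^ 2 + 2 * (V - U * R) * (s ^ 1 * (1 - s) ^ 1)) ^ (-lam))
    fun s _ => by congr 1; ring]
  rw [ordinaryHypergeometric_eq_of_hasSum (y := (U ^ (-b) * R ^ (b - 2 * lam))⁻¹ * _)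
    (Eq.subst (motive := fun f : ℕ → ℂ => HasSum f _) (funext fun m => ?_) (h.mul_left _)),
    mul_inv_cancel_left₀ hK]
  have hp : (ascPochhammer ℂ (2 * m)).eval (2 * lam) ≠ 0 := ascPochhammer_eval_ne_zero hc _
  -- Duplication gives (2 lam)_{2m} = 4^m (lam)_m (lam + 1/2)_m: (lam)_m cancels the binomial
  -- coefficient's numerator, and 4^m goes into the argument.
  rw [ascPochhammer_eval_two_mul] at hp ⊢
  have hw : (1 - V / (U * R)) / 2 = -(2 * (V - U * R)) / (4 * (U * R)) := by
    field_simp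
    ring
  rw [hw, one_mul, neg_add, ← sub_eq_add_neg, Complex.cpow_sub (-b) _ hU0,
    Complex.cpow_sub (b - 2 * lam) m hR0,
    Complex.cpow_natCast, Complex.cpow_natCast, ordinaryHypergeometricCoefficient, div_pow, mul_pow,
    mul_pow]
  have h1 := left_ne_zero_of_mul hp
  have h2 := right_ne_zero_of_mul hp
  have h3 := right_ne_zero_of_mul h1
  have h4 := left_ne_zero_of_mul hK
  have h5 := right_ne_zero_of_mul hK
  field_simp

/-- With (i, j) = (0, 2) the terms contain (2 lam - b)_{2m}, which duplication splits. The upper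
parameters then add up to 2 lam, as a Legendre function of order 1/2 - lam requires, only for b =
1/2. The hypothesis `hQ` lets the power of U²Q split. -/
theorem betaFunctional_half_quadratic_cpow {lam : ℂ} (hc : ∀ k : ℕ, 2 * lam ≠ -k)
    {R U V : ℂ} (hU : ‖U - 1‖ ≤ 1 / 10) (hU2 : ‖U ^ 2 - 1‖ ≤ 1 / 10) (hV : ‖V - 1‖ ≤ 1 / 10)
    (hD : ‖U ^ 2 * R ^ 2 - V ^ 2‖ ≤ 1 / 100)
    (hQ : ∀ s ∈ Metric.sphere (0 : ℂ) 2,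
      0 < (R ^ 2 * (1 - s) ^ 2 + 2 * V * (s * (1 - s)) + U ^ 2 * s ^ 2).re) :
    betaFunctional (1 / 2) (2 * lam)
        (fun s => (R ^ 2 * (1 - s) ^ 2 + 2 * V * (s * (1 - s)) + U ^ 2 * s ^ 2) ^ (-lam)) =
      U ^ (2 * lam - 1) * V ^ (1 / 2 - 2 * lam) *
        ordinaryHypergeometric (lam - 1 / 4) (lam + 1 / 4) (lam + 1 / 2)
          (1 - (U * R / V) ^ 2) := by
  have hV0 : V ≠ 0 := by rintro rfl; norm_num at hV
  have hU0 : U ≠ 0 := by rintro rfl; norm_num at hU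
  have hUre := Complex.re_pos_of_norm_sub_one_lt (hU.trans_lt (by norm_num))
  have hU2re := Complex.re_pos_of_norm_sub_one_lt (hU2.trans_lt (by norm_num))
  have hK : U ^ (-1 : ℂ) * V ^ (1 / 2 - 2 * lam) ≠ 0 := by
    simp [Complex.cpow_eq_zero_iff, hV0, hU0]
  have h := hasSum_betaFunctional_segment_sq_add_cpow (1 / 2) hc hV hU2 hD (i := 0) (j := 2) rfl
  rw [betaFunctional_congr (1 / 2) (2 * lam) (g := fun s => U ^ (2 * lam) *
    ((V * (1 - s) + U ^ 2 * s) ^ 2 + (U ^ 2 * R ^ 2 - V ^ 2) * (s ^ 0 * (1 - s) ^ 2)) ^ (-lam))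
    fun s hs => by
      rw [show (V * (1 - s) + U ^ 2 * s) ^ 2 + (U ^ 2 * R ^ 2 - V ^ 2) * (s ^ 0 * (1 - s) ^ 2) =
        U ^ 2 * (R ^ 2 * (1 - s) ^ 2 + 2 * V * (s * (1 - s)) + U ^ 2 * s ^ 2) by ring,
        Complex.mul_cpow_of_re_pos hU2re (hQ s hs), Complex.sq_cpow_of_re_pos hUre,
        ← mul_assoc (U ^ (2 * lam)),
        ← Complex.cpow_add _ _ hU0]
      simp, betaFunctional_const_mul]
  rw [ordinaryHypergeometric_eq_of_hasSum (y := (U ^ (-1 : ℂ) * V ^ (1 / 2 - 2 * lam))⁻¹ * _)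
    (Eq.subst (motive := fun f : ℕ → ℂ => HasSum f _) (funext fun m => ?_) (h.mul_left _)),
    sub_eq_add_neg (2 * lam), Complex.cpow_add _ _ hU0, mul_assoc (U ^ (2 * lam)), mul_assoc,
    mul_inv_cancel_left₀ hK]
  have hp : (ascPochhammer ℂ (2 * m)).eval (2 * lam) ≠ 0 := ascPochhammer_eval_ne_zero hc _
  have hq : (ascPochhammer ℂ (2 * m)).eval (2 * lam - 1 / 2) =
      4 ^ m * (ascPochhammer ℂ m).eval (lam - 1 / 4) * (ascPochhammer ℂ m).eval (lam + 1 / 4) := by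
    rw [show 2 * lam - 1 / 2 = 2 * (lam - 1 / 4) by ring, ascPochhammer_eval_two_mul,
      show lam - 1 / 4 + 1 / 2 = lam + 1 / 4 by ring]
  rw [ascPochhammer_eval_two_mul] at hp ⊢
  have hw : 1 - (U * R / V) ^ 2 = -(U ^ 2 * R ^ 2 - V ^ 2) / V ^ 2 := by
    field_simp
    ring
  rw [hw, hq, zero_mul, Nat.cast_zero, add_zero, Complex.sq_cpow_of_re_pos hUre,
    Complex.cpow_sub (1 / 2 - 2 * lam) (2 * m : ℕ) hV0, Complex.cpow_natCast, ordinaryHypergeometricCoefficient, div_pow,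
    show (2 : ℂ) * -(1 / 2) = -1 by norm_num, ← pow_mul, ascPochhammer_zero, Polynomial.eval_one]
  have h1 := left_ne_zero_of_mul hp
  have h2 := right_ne_zero_of_mul hp
  have h3 := right_ne_zero_of_mul h1
  have h4 := left_ne_zero_of_mul hK
  have h5 := right_ne_zero_of_mul hK
  generalize V ^ (1 / 2 - 2 * lam) = y at h5 ⊢
  generalize (ascPochhammer ℂ m).eval (lam + 1 / 2) = p at h2 ⊢
  field_simp

/-! ### Legendre and Ferrers functions near z = 1 -/

theorem legendre_normalization_mul {μ : ℂ} (hμ : ∀ k : ℕ, μ ≠ k + 1) :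
    2 ^ (-μ) * Complex.Gamma (1 - μ) * (2 ^ μ / Complex.Gamma (1 - μ)) = 1 := by
  have hG : Complex.Gamma (1 - μ) ≠ 0 :=
    Complex.Gamma_ne_zero fun k hk => hμ k (by linear_combination -hk)
  have h2 : (2 : ℂ) ^ μ ≠ 0 := by simp [Complex.cpow_eq_zero_iff]
  rw [Complex.cpow_neg]
  field_simp

theorem sqSubOnePow_mul_neg {z : ℂ} (hz : z ∈ legendreDomain) (a : ℂ) :
    sqSubOnePow z a * sqSubOnePow z (-a) = 1 := by
  have h1 : z - 1 ≠ 0 := fun h => hz (by rw [sub_eq_zero.1 h]; simp)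
  have h2 : z + 1 ≠ 0 := fun h => hz (by rw [eq_neg_of_add_eq_zero_left h]; simp)
  rw [sqSubOnePow, sqSubOnePow, mul_mul_mul_comm, ← Complex.cpow_add _ _ h1,
    ← Complex.cpow_add _ _ h2]
  simp

theorem oneSubSqPow_mul_neg {z : ℂ} (hz : z ∈ ferrersDomain) (a : ℂ) :
    oneSubSqPow z a * oneSubSqPow z (-a) = 1 := by
  have h : 1 - z ^ 2 ≠ 0 := fun h => by
    have : (z - 1) * (z + 1) = 0 := by linear_combination -h
    rcases mul_eq_zero.1 this with h | h
    · exact hz (by rw [sub_eq_zero.1 h]; simp)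
    · exact hz (by rw [eq_neg_of_add_eq_zero_left h]; simp)
  rw [oneSubSqPow, oneSubSqPow, ← Complex.cpow_add _ _ h]
  simp

theorem gaussF_of_norm_lt_one (a b c : ℂ) {w : ℂ} (hw : ‖w‖ < 1) :
    gaussF a b c w = ordinaryHypergeometric a b c w := if_pos hw

/-- The analytic germ at `z = 1` of `(z² - 1)^(μ/2) P_ν^μ(z)`. -/
noncomputable def legendreGerm (ν μ z : ℂ) : ℂ :=
  2 ^ μ / Complex.Gamma (1 - μ) *
    ordinaryHypergeometric (-ν - μ) (1 + ν - μ) (1 - μ) ((1 - z) / 2)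

/-- On each cut domain the powers with exponents μ/2 and -μ/2 cancel, leaving the same
hypergeometric series in (1-z)/2. -/
theorem isLegendreGerm_legendreGerm (ν μ : ℂ) : IsLegendreGerm ν μ (legendreGerm ν μ) := by
  have hsmall : ∀ᶠ z in 𝓝 (1 : ℂ), ‖(1 - z) / 2‖ < 1 := by
    have : Continuous fun z : ℂ => ‖(1 - z) / 2‖ := by fun_prop
    exact (this.tendsto 1).eventually (gt_mem_nhds (by simp))
  refine ⟨?_, ?_, ?_⟩
  · refine analyticAt_const.mul (AnalyticAt.comp_of_eq
      (analyticAt_ordinaryHypergeometric_zero _ _ _) (by fun_prop) (by simp))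
  · filter_upwards [hsmall] with z hz hzd
    rw [legendreP, gaussF_of_norm_lt_one _ _ _ hz, legendreGerm]
    have h := sqSubOnePow_mul_neg hzd (μ / 2)
    rw [← neg_div] at h
    generalize ordinaryHypergeometric (-ν - μ) (1 + ν - μ) (1 - μ) ((1 - z) / 2) = G
    linear_combination -(2 ^ μ / Complex.Gamma (1 - μ) * G) * h
  · filter_upwards [hsmall] with z hz hzd
    rw [ferrersP, gaussF_of_norm_lt_one _ _ _ hz, legendreGerm]
    have h := oneSubSqPow_mul_neg hzd (μ / 2)
    rw [← neg_div] at h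
    generalize ordinaryHypergeometric (-ν - μ) (1 + ν - μ) (1 - μ) ((1 - z) / 2) = G
    linear_combination -(2 ^ μ / Complex.Gamma (1 - μ) * G) * h

theorem legendreGenerating_of_hasSum {c : ℕ → ℂ} {A B z : ℂ → ℂ} {ν μ : ℂ}
    (hμ : ∀ k : ℕ, μ ≠ k + 1) (hz : ContinuousAt z 0) (hz0 : z 0 = 1)
    (h : ∀ᶠ t in 𝓝 (0 : ℂ), HasSum (fun n : ℕ => c n * t ^ n)
      (A t * B t * ordinaryHypergeometric (-ν - μ) (1 + ν - μ) (1 - μ) ((1 - z t) / 2))) :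
    LegendreGenerating c (fun t => 2 ^ (-μ) * Complex.Gamma (1 - μ) * A t * B t) ν μ z := by
  have hgerm := isLegendreGerm_legendreGerm ν μ
  have hz1 : Tendsto z (𝓝 0) (𝓝 1) := by simpa [ContinuousAt, hz0] using hz
  have hsum : ∀ᶠ t in 𝓝 (0 : ℂ), HasSum (fun n : ℕ => c n * t ^ n)
      (2 ^ (-μ) * Complex.Gamma (1 - μ) * A t * B t * legendreGerm ν μ (z t)) := by
    filter_upwards [h] with t ht
    convert ht using 1
    rw [legendreGerm]
    generalize ordinaryHypergeometric (-ν - μ) (1 + ν - μ) (1 - μ) ((1 - z t) / 2) = G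
    linear_combination (A t * B t * G) * legendre_normalization_mul hμ
  refine ⟨⟨_, hgerm, hsum⟩, ?_, ?_⟩
  · filter_upwards [hsum, hz1.eventually hgerm.legendre] with t ht h1 hd
    rwa [← h1 hd]
  · filter_upwards [hsum, hz1.eventually hgerm.ferrers] with t ht h1 hd
    rwa [← h1 hd]

/-! ### R, U and V near t = 0, and the theorem -/

theorem genR_sq (x t : ℂ) : genR x t ^ 2 = 1 - 2 * x * t + t ^ 2 := by
  rw [genR, one_div]
  exact Complex.cpow_nat_inv_pow _ two_ne_zero

theorem genU_sq (u x t : ℂ) :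
    genU u x t ^ 2 = 1 - 2 * (1 - u) * x * t + (1 - u) ^ 2 * t ^ 2 := by
  rw [genU, one_div]
  exact Complex.cpow_nat_inv_pow _ two_ne_zero

theorem genR_zero (x : ℂ) : genR x 0 = 1 := by simp [genR]

theorem genU_zero (u x : ℂ) : genU u x 0 = 1 := by simp [genU]

theorem genV_zero (u x : ℂ) : genV u x 0 = 1 := by simp [genV, genR_zero]

theorem continuousAt_genR (x : ℂ) : ContinuousAt (genR x) 0 :=
  ContinuousAt.cpow (by fun_prop) continuousAt_const (by simp)

theorem continuousAt_genU (u x : ℂ) : ContinuousAt (genU u x) 0 :=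
  ContinuousAt.cpow (by fun_prop) continuousAt_const (by simp)

theorem continuousAt_genV (u x : ℂ) : ContinuousAt (genV u x) 0 :=
  ((continuousAt_genR x).pow 2).add (by fun_prop)

/-- As a quadratic in s, the base takes the value R² at s = 0 and U² at s = 1; V is the remaining
Bernstein coefficient. -/
theorem gegenbauer_base_eq_quadratic (u x t s : ℂ) :
    1 - 2 * x * (t * (1 - u * s)) + (t * (1 - u * s)) ^ 2 =
      genR x t ^ 2 * (1 - s) ^ 2 + 2 * genV u x t * (s * (1 - s)) + genU u x t ^ 2 * s ^ 2 := by
  rw [genV, genR_sq, genU_sq]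
  ring

theorem eventually_norm_sub_le {f : ℂ → ℂ} {a : ℂ} (hf : ContinuousAt f 0) (h0 : f 0 = a) {r : ℝ}
    (hr : 0 < r) : ∀ᶠ t in 𝓝 (0 : ℂ), ‖f t - a‖ ≤ r := by
  have h : Tendsto (fun t => ‖f t - a‖) (𝓝 0) (𝓝 0) := by
    simpa [ContinuousAt, h0] using (hf.sub (continuousAt_const (y := a))).norm
  exact (h.eventually (gt_mem_nhds hr)).mono fun t ht => ht.le

theorem eventually_hasSum_hypergeometric_mul_gegenbauerC (b : ℂ) {lam : ℂ}
    (hc : ∀ k : ℕ, 2 * lam ≠ -k) (u x : ℂ) :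
    ∀ᶠ t in 𝓝 (0 : ℂ), HasSum
      (fun n : ℕ => ordinaryHypergeometric (-(n : ℂ)) b (2 * lam) u * gegenbauerC lam n x * t ^ n)
      (genU u x t ^ (-b) * genR x t ^ (b - 2 * lam) *
        ordinaryHypergeometric (2 * lam - b) b (lam + 1 / 2)
          ((1 - genV u x t / (genU u x t * genR x t)) / 2)) := by
  have hR := continuousAt_genR x
  have hU := continuousAt_genU u x
  have hV := continuousAt_genV u x
  filter_upwards [hasSum_hypergeometric_mul_gegenbauerC b (2 * lam) lam u x,
    eventually_norm_sub_le hR (genR_zero x) (r := 1 / 10) (by norm_num),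
    eventually_norm_sub_le hU (genU_zero u x) (r := 1 / 10) (by norm_num),
    eventually_norm_sub_le (f := fun t => 2 * (genV u x t - genU u x t * genR x t)) (a := 0)
      (continuousAt_const.mul (hV.sub (hU.mul hR)))
      (by simp [genR_zero, genU_zero, genV_zero]) (r := 1 / 100) (by norm_num)]
    with t ht h1 h2 h3
  rw [sub_zero] at h3
  simp only [gegenbauer_base_eq_quadratic] at ht
  rwa [betaFunctional_quadratic_cpow b hc h1 h2 h3] at ht

theorem eventually_hasSum_hypergeometric_half_mul_gegenbauerC {lam : ℂ}
    (hc : ∀ k : ℕ, 2 * lam ≠ -k) (u x : ℂ) :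
    ∀ᶠ t in 𝓝 (0 : ℂ), HasSum
      (fun n : ℕ =>
        ordinaryHypergeometric (-(n : ℂ)) (1 / 2) (2 * lam) u * gegenbauerC lam n x * t ^ n)
      (genU u x t ^ (2 * lam - 1) * genV u x t ^ (1 / 2 - 2 * lam) *
        ordinaryHypergeometric (lam - 1 / 4) (lam + 1 / 4) (lam + 1 / 2)
          (1 - (genU u x t * genR x t / genV u x t) ^ 2)) := by
  have hR := continuousAt_genR x
  have hU := continuousAt_genU u x
  have hV := continuousAt_genV u x
  have hr : 0 < 1 / (2 * (‖x‖ + 1)) := by positivity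
  filter_upwards [hasSum_hypergeometric_mul_gegenbauerC (1 / 2) (2 * lam) lam u x,
    eventually_norm_sub_le hU (genU_zero u x) (r := 1 / 10) (by norm_num),
    eventually_norm_sub_le (hU.pow 2) (a := 1) (by simp [genU_zero]) (r := 1 / 10) (by norm_num),
    eventually_norm_sub_le hV (genV_zero u x) (r := 1 / 10) (by norm_num),
    eventually_norm_sub_le (a := 0) (((hU.pow 2).mul (hR.pow 2)).sub (hV.pow 2))
      (by simp [genR_zero, genU_zero, genV_zero]) (r := 1 / 100) (by norm_num),
    eventually_norm_mul_one_sub_mul_lt u (half_pos hr)]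
    with t ht h1 h2 h3 h4 h5
  rw [sub_zero] at h4
  simp only [gegenbauer_base_eq_quadratic] at ht
  rwa [betaFunctional_half_quadratic_cpow hc h1 h2 h3 h4 fun s hs => ?_] at ht
  -- In its original form Q is visibly within distance 1 of 1 for small t, which gives the positive
  -- real part.
  rw [← gegenbauer_base_eq_quadratic]
  exact Complex.re_pos_of_norm_sub_one_lt
    (norm_gegenbauer_base_sub_one_lt ((h5 s hs).trans_lt (half_lt_self hr)))

theorem mainTheorem8 (μ : ℂ) (hμ : ∀ k : ℕ, μ ≠ ((k : ℂ) + 1) / 2) (u x : ℂ) :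
    (∀ ν : ℂ,
      LegendreGenerating
        (fun n : ℕ => ordinaryHypergeometric (-(n : ℂ)) (ν - μ + 1) (1 - 2 * μ) u *
          gegenbauerC (1 / 2 - μ) n x)
        (fun t : ℂ => 2 ^ (-μ) * Complex.Gamma (1 - μ) *
          genU u x t ^ (-ν + μ - 1) * genR x t ^ (ν + μ))
        ν μ
        (fun t : ℂ => genV u x t / (genU u x t * genR x t))) ∧
    LegendreGenerating
      (fun n : ℕ => ordinaryHypergeometric (-(n : ℂ)) (1 / 2 : ℂ) (1 - 2 * μ) u *
        gegenbauerC (1 / 2 - μ) n x)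
      (fun t : ℂ => 2 ^ (-μ) * Complex.Gamma (1 - μ) *
        genU u x t ^ (-2 * μ) * genV u x t ^ (2 * μ - 1 / 2))
      (-1 / 4) μ
      (fun t : ℂ => 2 * (genU u x t * genR x t / genV u x t) ^ 2 - 1) := by
  have hc : ∀ k : ℕ, 2 * (1 / 2 - μ) ≠ -k := fun k hk => hμ k (by linear_combination -hk / 2)
  -- Positive integers are the excluded half-integers of odd index: k + 1 = ((2k + 1) + 1)/2.
  have hμ' : ∀ k : ℕ, μ ≠ k + 1 := fun k hk => hμ (2 * k + 1) (by rw [hk]; push_cast; ring)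
  have hR := continuousAt_genR x
  have hU := continuousAt_genU u x
  have hV := continuousAt_genV u x
  refine ⟨fun ν => ?_, ?_⟩
  · refine legendreGenerating_of_hasSum hμ'
      (hV.div (hU.mul hR) (by simp [genR_zero, genU_zero]))
      (by simp [genR_zero, genU_zero, genV_zero]) ?_
    filter_upwards [eventually_hasSum_hypergeometric_mul_gegenbauerC (ν - μ + 1) hc u x] with t ht
    rw [show 2 * (1 / 2 - μ) = 1 - 2 * μ by ring, show -(ν - μ + 1) = -ν + μ - 1 by ring,
      show ν - μ + 1 - (1 - 2 * μ) = ν + μ by ring,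
      show 1 - 2 * μ - (ν - μ + 1) = -ν - μ by ring,
      show 1 / 2 - μ + 1 / 2 = 1 - μ by ring] at ht
    rwa [show 1 + ν - μ = ν - μ + 1 by ring]
  · refine legendreGenerating_of_hasSum hμ'
      ((continuousAt_const.mul (((hU.mul hR).div hV (by simp [genV_zero])).pow 2)).sub
        continuousAt_const)
      (by norm_num [genR_zero, genU_zero, genV_zero]) ?_
    filter_upwards [eventually_hasSum_hypergeometric_half_mul_gegenbauerC hc u x] with t ht
    rw [show 2 * (1 / 2 - μ) = 1 - 2 * μ by ring, show 1 - 2 * μ - 1 = -2 * μ by ring,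
      show 1 / 2 - (1 - 2 * μ) = 2 * μ - 1 / 2 by ring,
      show 1 / 2 - μ + 1 / 2 = 1 - μ by ring] at ht
    rwa [show -(-1 / 4) - μ = 1 / 2 - μ - 1 / 4 by ring,
      show 1 + -1 / 4 - μ = 1 / 2 - μ + 1 / 4 by ring,
      show (1 - (2 * (genU u x t * genR x t / genV u x t) ^ 2 - 1)) / 2 =
        1 - (genU u x t * genR x t / genV u x t) ^ 2 by ring]
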